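/- **Theorem (impossibility for degrees-only local node differential privacy).** *Definitions.* Graphs are simple and undirected on the node set $[n]$; $N_i^G$ is the neighborhood of node $i$ in $G$. Two graphs are node neighbors if they differ only in edges incident to a single node. Two distributions $\mu,\nu$ are $(\varepsilon,\delta)$-indistinguishable if $\mu(E)\le e^{\varepsilon}\nu(E)+\delta$ and $\nu(E)\le e^{\varepsilon}\mu(E)+\delta$ for all events $E$. A randomized algorithm $\mathcal A$ on graphs is *(noninteractive) $(\varepsilon,\delta)$-LNDP* if there are a distribution of public random strings $\rho$, local randomizers $\mathcal R_{1,\rho},\dots,\mathcal R_{n,\rho}$ (using independent private randomness) and a (randomized) postprocessing algorithm $\mathcal P$ such that, for every $G$, $\mathcal A(G)$ is distributed as $\mathcal P(\mathcal R_{1,\rho}(N_1^G),\dots,\mathcal R_{n,\rho}(N_n^G))$ and, for all node neighbors $G,G'$ and every fixed $\rho$, the joint distributions of $(\mathcal R_{i,\rho}(N_i^G))_{i}$ and $(\mathcal R_{i,\rho}(N_i^{G'}))_{i}$ are $(\varepsilon,\delta)$-indistinguishable. It is *degrees-only* if moreover each $\mathcal R_{i,\rho}$ depends on the neighborhood only through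 the degree $|N_i^G|$. A graph on $[n]$ is *$t$-starpartite* if for some $T\subseteq[n]$ with $|T|=t$ its edges are exactly the pairs of distinct nodes with at least one member in $T$. Let $\mathcal G^{\mathrm{star}}_{n,t}$ and $\mathcal G^{\mathrm{reg}}_{n,t}$ be the uniform distributions over all $t$-starpartite, respectively all $t$-regular, graphs on $[n]$. *Statement.* There are absolute constants $c>0$ and $n_0\in\mathbb N$ such that the following holds for all $n\ge n_0$, all $\varepsilon\in(0,1]$, all $\delta\in\bigl(0,\frac1{100n}\bigr]$, and all integers $t\ge 0$ with $t\le \frac{c\sqrt n}{\varepsilon}$ for which both $\mathcal G^{\mathrm{star}}_{n,t}$ and $\mathcal G^{\mathrm{reg}}_{n,t}$ are defined (that is, $t$-starpartite and $t$-regular graphs on $[n]$ exist). For every degrees-only $(\varepsilon,\delta)$-LNDP algorithm $\mathcal A$, $$\Pr_{G\sim\mathcal G^{\mathrm{star}}_{n,t}}[\mathcal A(G)=\text{``starpartite''}]<\tfrac23\qquad\text{or}\qquad \Pr_{G\sim\mathcal G^{\mathrm{reg}}_{n,t}}[\mathcal A(G)=\text{``regular''}]<\tfrac23 .$$ -/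

import Mathlib

open MeasureTheory ProbabilityTheory
open scoped ENNReal

universe u v w

/-- Two graphs on the node set `Fin n` are node neighbors if they differ only in the set of edges
incident to some single node `i`. -/
def NodeNeighbors {n : ℕ} (G G' : SimpleGraph (Fin n)) : Prop :=
  ∃ i : Fin n, ∀ a b : Fin n, a ≠ i → b ≠ i → (G.Adj a b ↔ G'.Adj a b)

/-- `(ε, δ)`-indistinguishability of two distributions on the same outcome space. -/
def Indistinguishable {Y : Type*} [MeasurableSpace Y] (ε δ : ℝ) (μ ν : Measure Y) : Prop :=
  ∀ E : Set Y, MeasurableSet E →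
    μ E ≤ ENNReal.ofReal (Real.exp ε) * ν E + ENNReal.ofReal δ ∧
    ν E ≤ ENNReal.ofReal (Real.exp ε) * μ E + ENNReal.ofReal δ

/-- A noninteractive local protocol (with public randomness) on graphs with node set `Fin n` and
outputs in `Y`. Node `i` may send messages in its own space `Msg i`; `randomizer i S ρ` is the
distribution of the message of node `i` when its neighborhood is `S` and the public random string
is `ρ`. The server applies the randomized map `post` to the messages. -/
structure LocalProtocol (n : ℕ) (Y : Type w) [MeasurableSpace Y] where
  Pub : Type u
  [measurableSpacePub : MeasurableSpace Pub]
  pubLaw : Measure Pub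
  [isProbabilityMeasure_pubLaw : IsProbabilityMeasure pubLaw]
  Msg : Fin n → Type v
  [measurableSpaceMsg : ∀ i, MeasurableSpace (Msg i)]
  randomizer : ∀ i : Fin n, Set (Fin n) → Kernel Pub (Msg i)
  [isMarkovKernel_randomizer : ∀ i S, IsMarkovKernel (randomizer i S)]
  post : Kernel (∀ i, Msg i) Y
  [isMarkovKernel_post : IsMarkovKernel post]

namespace LocalProtocol

attribute [instance] LocalProtocol.measurableSpacePub
  LocalProtocol.isProbabilityMeasure_pubLaw LocalProtocol.measurableSpaceMsg
  LocalProtocol.isMarkovKernel_randomizer LocalProtocol.isMarkovKernel_post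

variable {n : ℕ} {Y : Type w} [MeasurableSpace Y]

/-- The joint distribution of all messages on the graph `G`, as a function of the public random
string `ρ`: given `ρ`, the nodes run their randomizers independently on their neighborhoods. -/
noncomputable def transcript (p : LocalProtocol.{u, v, w} n Y) (G : SimpleGraph (Fin n)) :
    Kernel p.Pub (∀ i, p.Msg i) where
  toFun ρ := Measure.pi fun i => p.randomizer i (G.neighborSet i) ρ
  measurable' := by
    refine Measurable.measure_of_isPiSystem_of_isProbabilityMeasure
      generateFrom_pi.symm isPiSystem_pi ?_
    rintro _ ⟨s, hs, rfl⟩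
    simp only [Measure.pi_pi]
    exact Finset.measurable_prod _ fun i _ =>
      (p.randomizer i (G.neighborSet i)).measurable_coe (hs i (Set.mem_univ i))

/-- The distribution of the final output on the graph `G`: draw the public randomness, then the
messages, then postprocess. -/
noncomputable def output (p : LocalProtocol.{u, v, w} n Y) (G : SimpleGraph (Fin n)) :
    Measure Y :=
  (p.pubLaw.bind (p.transcript G)).bind p.post

/-- Node privacy: for every setting of the public randomness, the joint distributions of the
messages on node-neighboring graphs are `(ε, δ)`-indistinguishable. -/
def NodePrivate (p : LocalProtocol.{u, v, w} n Y) (ε δ : ℝ) : Prop :=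
  ∀ G G' : SimpleGraph (Fin n), NodeNeighbors G G' →
    ∀ ρ : p.Pub, Indistinguishable ε δ (p.transcript G ρ) (p.transcript G' ρ)

/-- Every randomizer depends on the neighborhood of its node only through the degree. (The
neighborhoods of node `i` are the sets of nodes that do not contain `i`.) -/
def DegreesOnly (p : LocalProtocol.{u, v, w} n Y) : Prop :=
  ∀ (i : Fin n) (S S' : Set (Fin n)), i ∉ S → i ∉ S' → S.ncard = S'.ncard →
    p.randomizer i S = p.randomizer i S'

end LocalProtocol

/-- The randomized algorithm `A` (mapping a graph to the distribution of its output) is a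
degrees-only noninteractive locally `(ε, δ)`-node-differentially-private algorithm. -/
def IsDegreesOnlyLNDP {n : ℕ} {Y : Type w} [MeasurableSpace Y] (ε δ : ℝ)
    (A : SimpleGraph (Fin n) → Measure Y) : Prop :=
  ∃ p : LocalProtocol.{u, v, w} n Y,
    (∀ G, A G = p.output G) ∧ p.NodePrivate ε δ ∧ p.DegreesOnly

/-- The starpartite graph with center `T`: its edges are the pairs of distinct nodes that meet
`T`. -/
def starpartiteGraph {n : ℕ} (T : Finset (Fin n)) : SimpleGraph (Fin n) where
  Adj i j := i ≠ j ∧ (i ∈ T ∨ j ∈ T)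
  symm := ⟨fun _ _ h => ⟨h.1.symm, h.2.symm⟩⟩
  loopless := ⟨fun _ h => h.1 rfl⟩

open Classical in
/-- The `t`-starpartite graphs on `Fin n`. -/
noncomputable def starpartiteGraphs (n t : ℕ) : Finset (SimpleGraph (Fin n)) :=
  Finset.univ.filter fun G => ∃ T : Finset (Fin n), T.card = t ∧ G = starpartiteGraph T

open Classical in
/-- The `t`-regular graphs on `Fin n`. -/
noncomputable def regularGraphs (n t : ℕ) : Finset (SimpleGraph (Fin n)) :=
  Finset.univ.filter fun G => G.IsRegularOfDegree t

open Classical in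
/-- The probability that `A(G) = y` when `G` is drawn from `D` (over the choice of `G` and the
randomness of `A`). -/
noncomputable def outputProb {n : ℕ} {Y : Type w} [MeasurableSpace Y]
    (D : PMF (SimpleGraph (Fin n))) (A : SimpleGraph (Fin n) → Measure Y) (y : Y) : ℝ≥0∞ :=
  ∑ G : SimpleGraph (Fin n), D G * A G {y}

/-! Fix the public string and a `t`-regular graph. A degrees-only protocol sees independent messages
with laws `P i` (degree `t`) on every `t`-regular graph. On the starpartite graph with center `T`
the laws at `i ∈ T` become `Q i` (degree `n - 1`). So the server must detect `t` planted coordinates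
at uniformly random positions, where privacy makes each `Q i` indistinguishable from `P i`.

This is settled by a second moment argument. `Indistinguishable.exists_truncated_density` replaces
`Q i` by a density with mean at least `1 - δ` and second moment at most `1 + x`, `x = 6ε² + 2δ`. A
product of the likelihoods for `T` and `T'` then has mean at most `(1 + x) ^ #(T ∩ T')`, and
`sum_pow_card_inter_le` bounds its average over `T` by `exp (x t² / n)`, which is near 1 when `tε ≪
√n` and `δ ≲ 1/n`. Hence the averaged likelihood concentrates near 1, and
`sum_integral_plantedPi_le` shows that every test gains at most `3/10`. Two success probabilities of
at least `2/3` would need a gain of `1/3`. -/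

/-! ### Truncated likelihood ratios of indistinguishable laws. -/

section Density

variable {X : Type*} [MeasurableSpace X]

lemma Indistinguishable.measureReal_le {ε δ : ℝ} (hδ : 0 ≤ δ) {μ ν : Measure X}
    [IsFiniteMeasure μ] [IsFiniteMeasure ν] (h : Indistinguishable ε δ μ ν)
    {E : Set X} (hE : MeasurableSet E) :
    μ.real E ≤ Real.exp ε * ν.real E + δ ∧ ν.real E ≤ Real.exp ε * μ.real E + δ := by
  obtain ⟨h₁, h₂⟩ := h E hE
  have key : ∀ (α β : Measure X) [IsFiniteMeasure α] [IsFiniteMeasure β],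
      α E ≤ ENNReal.ofReal (Real.exp ε) * β E + ENNReal.ofReal δ →
      α.real E ≤ Real.exp ε * β.real E + δ := by
    intro α β _ _ h
    have := ENNReal.toReal_mono (by finiteness) h
    rwa [ENNReal.toReal_add (by finiteness) (by finiteness), ENNReal.toReal_mul,
      ENNReal.toReal_ofReal (Real.exp_pos ε).le, ENNReal.toReal_ofReal hδ] at this
  exact ⟨key μ ν h₁, key ν μ h₂⟩

/-- If `Q` and `P` are `(ε, δ)`-indistinguishable, then `Q` dominates a measure with density `f`
with respect to `P` that has almost full mass and whose second moment is close to `1`. -/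
lemma Indistinguishable.exists_truncated_density {P Q : Measure X} [IsProbabilityMeasure P]
    [IsProbabilityMeasure Q] {ε δ : ℝ} (hε₀ : 0 ≤ ε) (hε₁ : ε ≤ 1) (hδ : 0 ≤ δ)
    (h : Indistinguishable ε δ Q P) :
    ∃ f : X → ℝ, Measurable f ∧ (∀ x, 0 ≤ f x) ∧ (∀ x, f x ≤ Real.exp ε) ∧
      P.withDensity (fun x => ENNReal.ofReal (f x)) ≤ Q ∧ 1 - δ ≤ ∫ x, f x ∂P ∧
      ∫ x, f x ∂P ≤ 1 ∧ ∫ x, f x ^ 2 ∂P ≤ 1 + (6 * ε ^ 2 + 2 * δ) := by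
  set g := Q.rnDeriv P with hg
  have hgm : Measurable g := Measure.measurable_rnDeriv Q P
  set r : X → ℝ := fun x => (g x).toReal with hr
  have hrm : Measurable r := hgm.ennreal_toReal
  have hr0 : ∀ x, 0 ≤ r x := fun x => ENNReal.toReal_nonneg
  have hrint : Integrable r P := Measure.integrable_toReal_rnDeriv
  -- `S` carries all of `P` and none of the singular part of `Q`, so on `S` the law `Q` has density
  -- `r`.
  obtain ⟨S, hS, hS0, hPS⟩ := Measure.mutuallySingular_singularPart Q P
  have hPE : ∀ E, MeasurableSet E → P.real (E ∩ S) = P.real E := by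
    intro E hE
    rw [measureReal_def, measureReal_def]
    congr 1
    refine measure_congr ?_
    refine inter_ae_eq_left_of_ae_eq_univ ?_
    exact ae_eq_univ.2 hPS
  have hQE : ∀ E, MeasurableSet E → Q.real (E ∩ S) = ∫ x in E, r x ∂P := by
    intro E hE
    have h1 : Q (E ∩ S) = ∫⁻ x in E, g x ∂P := by
      conv_lhs => rw [Measure.haveLebesgueDecomposition_add Q P]
      rw [Measure.add_apply, measure_mono_null Set.inter_subset_right hS0, zero_add,
        withDensity_apply _ (hE.inter hS)]
      refine setLIntegral_congr (inter_ae_eq_left_of_ae_eq_univ (ae_eq_univ.2 hPS))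
    rw [measureReal_def, h1, integral_toReal hgm.aemeasurable]
    exact ae_restrict_of_ae (Measure.rnDeriv_lt_top Q P)
  set e := Real.exp ε with he
  have he1 : 1 ≤ e := Real.one_le_exp hε₀
  have he2 : e ≤ 1 + 2 * ε := by
    have := Real.abs_exp_sub_one_le (x := ε) (by rwa [abs_of_nonneg hε₀])
    rw [abs_of_nonneg hε₀] at this
    linarith [le_abs_self (Real.exp ε - 1)]
  have he3 : (1 - ε) * e ≤ 1 := by
    have h1 : 1 - ε ≤ Real.exp (-ε) := by linarith [Real.add_one_le_exp (-ε)]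
    calc (1 - ε) * e ≤ Real.exp (-ε) * e := by gcongr
      _ = 1 := by rw [he, ← Real.exp_add]; simp
  set f : X → ℝ := fun x => min (r x) e with hf
  have hfm : Measurable f := hrm.min measurable_const
  have hf0 : ∀ x, 0 ≤ f x := fun x => le_min (hr0 x) (by linarith)
  have hfe : ∀ x, f x ≤ e := fun x => min_le_right _ _
  have hfint : Integrable f P := by
    refine Integrable.of_bound hfm.aestronglyMeasurable e (Filter.Eventually.of_forall fun x => ?_)
    rw [Real.norm_eq_abs, abs_of_nonneg (hf0 x)]; exact hfe x
  have hf2int : Integrable (fun x => f x ^ 2) P := by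
    refine Integrable.of_bound (hfm.pow_const 2).aestronglyMeasurable (e ^ 2)
      (Filter.Eventually.of_forall fun x => ?_)
    rw [Real.norm_eq_abs, abs_of_nonneg (sq_nonneg _)]
    exact pow_le_pow_left₀ (hf0 x) (hfe x) 2
  have hle1 : ∫ x, f x ∂P ≤ 1 := by
    calc ∫ x, f x ∂P ≤ ∫ x, r x ∂P := integral_mono hfint hrint fun x => min_le_left _ _
      _ = Q.real (Set.univ ∩ S) := by rw [hQE _ .univ, setIntegral_univ]
      _ ≤ 1 := measureReal_le_one
  refine ⟨f, hfm, hf0, hfe, ?_, ?_, hle1, ?_⟩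
  · refine le_trans (withDensity_mono (Filter.Eventually.of_forall fun x => ?_))
      (Measure.withDensity_rnDeriv_le Q P)
    exact (ENNReal.ofReal_le_ofReal (min_le_left _ _)).trans ENNReal.ofReal_toReal_le
  -- Truncation and the singular part together lose `Q (A ∪ Sᶜ) - e * P A`, which privacy for that
  -- event bounds by `δ`.
  · set A : Set X := {x | e < r x} with hA
    have hAm : MeasurableSet A := measurableSet_lt measurable_const hrm
    have h1 : ∫ x, f x ∂P = e * P.real A + Q.real (Aᶜ ∩ S) := by
      rw [← integral_add_compl hAm hfint, hQE _ hAm.compl]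
      congr 1
      · rw [setIntegral_congr_fun (g := fun _ => e) hAm (fun x hx => min_eq_right (le_of_lt hx))]
        simp [mul_comm]
      · exact setIntegral_congr_fun hAm.compl (fun x hx => min_eq_left (not_lt.1 hx))
    have h2 := (h.measureReal_le hδ (hAm.union hS.compl)).1
    have h3 : Q.real (A ∪ Sᶜ) = 1 - Q.real (Aᶜ ∩ S) := by
      rw [← probReal_compl_eq_one_sub (hAm.compl.inter hS), Set.compl_inter, compl_compl]
    have h4 : P.real (A ∪ Sᶜ) ≤ P.real A := by
      refine (measureReal_union_le _ _).trans ?_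
      simp [measureReal_def, hPS]
    have h5 : e * P.real (A ∪ Sᶜ) ≤ e * P.real A := by gcongr
    linarith
  -- The reverse privacy inequality on `B` bounds the mean of `(1 - e * r)⁺` by `δ`. Off `B`, `f`
  -- lies in `[1 - ε, 1 + 2ε]`. The resulting bound on `(f - 1) ^ 2` gives the second moment, since
  -- `f` has mean at most 1.
  · set B : Set X := {x | e * r x < 1} with hB
    have hBm : MeasurableSet B := measurableSet_lt (hrm.const_mul e) measurable_const
    have h1 := (h.measureReal_le hδ (hBm.inter hS)).2
    rw [hPE _ hBm, hQE _ hBm] at h1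
    have hint1 : Integrable (fun x => 1 - e * r x) P := (integrable_const 1).sub (hrint.const_mul e)
    have h2 : ∫ x, B.indicator (fun x => 1 - e * r x) x ∂P ≤ δ := by
      rw [integral_indicator hBm, integral_sub (integrable_const 1).integrableOn
        (hrint.const_mul e).integrableOn, integral_const_mul]
      simp
      linarith
    have hpt : ∀ x, f x ^ 2 ≤ 2 * f x + (2 * B.indicator (fun x => 1 - e * r x) x
        + (6 * ε ^ 2 - 1)) := by
      intro x
      have key : (f x - 1) ^ 2 ≤ 6 * ε ^ 2 + 2 * B.indicator (fun x => 1 - e * r x) x := by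
        by_cases hx : x ∈ B
        · rw [Set.indicator_of_mem hx]
          have hx' : e * r x < 1 := hx
          have hre : r x ≤ e * r x := by nlinarith [hr0 x]
          have hfr : f x = r x := min_eq_left (by linarith)
          rw [hfr]
          -- By `he3`, `e - 1 ≤ ε * e`, so `(e - 1) * r ≤ ε * (e * r) ≤ ε` on `B`.
          have hu : 1 - r x ≤ ε + (1 - e * r x) := by
            nlinarith [hr0 x]
          nlinarith [hr0 x, sq_nonneg (ε - (1 - e * r x)),
            mul_nonneg (by linarith : (0:ℝ) ≤ e) (hr0 x)]
        · rw [Set.indicator_of_notMem hx]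
          have hx' : 1 ≤ e * r x := not_lt.1 hx
          have h3 : 1 ≤ e * f x := by
            rcases min_cases (r x) e with h | h
            · rw [hf]; simp only [h.1]; exact hx'
            · rw [hf]; simp only [h.1]; nlinarith
          have h4 : 1 - ε ≤ f x := by nlinarith [hf0 x]
          have h5 := hfe x
          nlinarith
      nlinarith
    have hi3 : Integrable (fun x => 2 * B.indicator (fun x => 1 - e * r x) x) P :=
      (hint1.indicator hBm).const_mul 2
    calc ∫ x, f x ^ 2 ∂P ≤ ∫ x, (2 * f x + (2 * B.indicator (fun x => 1 - e * r x) x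
        + (6 * ε ^ 2 - 1))) ∂P :=
          integral_mono hf2int ((hfint.const_mul 2).add (hi3.add (integrable_const _))) hpt
      _ = 2 * ∫ x, f x ∂P + (2 * ∫ x, B.indicator (fun x => 1 - e * r x) x ∂P
          + (6 * ε ^ 2 - 1)) := by
        have hi4 : Integrable (fun x => 2 * B.indicator (fun x => 1 - e * r x) x
            + (6 * ε ^ 2 - 1)) P := hi3.add (integrable_const _)
        rw [integral_add (hfint.const_mul 2) hi4,
          integral_add hi3 (integrable_const _), integral_const_mul, integral_const_mul]
        simp
      _ ≤ _ := by linarith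

end Density

/-! ### Domination and densities of product measures. -/

section Pi

variable {ι : Type*} [Fintype ι] {X : ι → Type*} [∀ i, MeasurableSpace (X i)]

/-- The product outer measure is the largest one bounded on boxes by the product of the side
measures, so comparing boxes suffices. -/
lemma measure_pi_mono {μ ν : ∀ i, Measure (X i)} [∀ i, SigmaFinite (μ i)]
    (h : ∀ i, μ i ≤ ν i) : Measure.pi μ ≤ Measure.pi ν := by
  have key : (Measure.pi μ).toOuterMeasure ≤ OuterMeasure.pi fun i => (ν i).toOuterMeasure := by
    rw [OuterMeasure.le_pi]
    intro s _
    have := Measure.pi_pi μ s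
    refine le_trans this.le ?_
    exact Finset.prod_le_prod' fun i _ => h i (s i)
  refine Measure.le_iff.2 fun s hs => ?_
  rw [Measure.pi_def ν, toMeasure_apply _ _ hs]
  exact key s

lemma pi_withDensity_ofReal {μ : ∀ i, Measure (X i)} [∀ i, IsFiniteMeasure (μ i)]
    {f : ∀ i, X i → ℝ} (hf0 : ∀ i x, 0 ≤ f i x)
    (hint : ∀ i, Integrable (f i) (μ i)) :
    Measure.pi (fun i => (μ i).withDensity fun x => ENNReal.ofReal (f i x)) =
      (Measure.pi μ).withDensity fun x => ENNReal.ofReal (∏ i, f i (x i)) := by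
  classical
  have : ∀ i, IsFiniteMeasure ((μ i).withDensity fun x => ENNReal.ofReal (f i x)) := fun i =>
    isFiniteMeasure_withDensity_ofReal (hint i).2
  refine Measure.pi_eq fun s hs => ?_
  rw [withDensity_apply _ (MeasurableSet.univ_pi hs),
    ← lintegral_indicator (MeasurableSet.univ_pi hs)]
  have h1 : ∀ x : ∀ i, X i, (Set.univ.pi s).indicator
      (fun x => ENNReal.ofReal (∏ i, f i (x i))) x =
      ENNReal.ofReal (∏ i, (s i).indicator (f i) (x i)) := by
    intro x
    by_cases hx : x ∈ Set.univ.pi s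
    · rw [Set.indicator_of_mem hx]
      congr 1
      exact Finset.prod_congr rfl fun i _ => (Set.indicator_of_mem (hx i trivial) _).symm
    · rw [Set.indicator_of_notMem hx]
      obtain ⟨i, hi⟩ : ∃ i, x i ∉ s i := by simpa [Set.mem_pi] using hx
      rw [Finset.prod_eq_zero (Finset.mem_univ i) (Set.indicator_of_notMem hi _)]
      simp
  have hi : ∀ i, Integrable ((s i).indicator (f i)) (μ i) := fun i => (hint i).indicator (hs i)
  have hnn : ∀ i x, 0 ≤ (s i).indicator (f i) x := fun i x =>
    Set.indicator_nonneg (fun y _ => hf0 i y) x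
  simp_rw [h1]
  rw [← ofReal_integral_eq_lintegral_ofReal (Integrable.fintype_prod_dep hi)
    (Filter.Eventually.of_forall fun x => Finset.prod_nonneg fun i _ => hnn i _),
    integral_fintype_prod_eq_prod, ENNReal.ofReal_prod_of_nonneg
      (fun i _ => integral_nonneg (hnn i))]
  refine Finset.prod_congr rfl fun i _ => ?_
  rw [ofReal_integral_eq_lintegral_ofReal (hi i) (Filter.Eventually.of_forall (hnn i)),
    withDensity_apply _ (hs i), ← lintegral_indicator (hs i)]
  refine lintegral_congr fun x => ?_
  by_cases hx : x ∈ s i <;> simp [hx]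

end Pi

/-! ### Intersections of random `t`-sets. -/

section Combinatorics

open Finset

/-- Each factor of the ratio of descending factorials satisfies `(t - j) / (n - j) ≤ t / n`. -/
lemma choose_mul_pow_le {t n : ℕ} (h : t ≤ n) (s : ℕ) :
    t.choose s * n ^ s ≤ n.choose s * t ^ s := by
  have hd : t.descFactorial s * n ^ s ≤ n.descFactorial s * t ^ s := by
    induction s with
    | zero => simp
    | succ s ih =>
      have h1 : (t - s) * n ≤ (n - s) * t := by
        rw [Nat.sub_mul, Nat.sub_mul, mul_comm t n]
        exact Nat.sub_le_sub_left (Nat.mul_le_mul_left s h) _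
      calc t.descFactorial (s + 1) * n ^ (s + 1)
          = ((t - s) * n) * (t.descFactorial s * n ^ s) := by
            rw [Nat.descFactorial_succ, pow_succ]; ring
        _ ≤ ((n - s) * t) * (n.descFactorial s * t ^ s) := Nat.mul_le_mul h1 ih
        _ = _ := by rw [Nat.descFactorial_succ, pow_succ]; ring
  rw [Nat.descFactorial_eq_factorial_mul_choose, Nat.descFactorial_eq_factorial_mul_choose,
    mul_assoc, mul_assoc] at hd
  exact Nat.le_of_mul_le_mul_left hd s.factorial_pos

variable {ι : Type*} [Fintype ι] [DecidableEq ι]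

/-- A uniformly random `t`-set contains `S` with probability at most `(t / n) ^ #S`, as if its
elements were chosen independently. -/
lemma card_filter_superset_le (S : Finset ι) (t : ℕ) :
    #{T ∈ powersetCard t (univ : Finset ι) | S ⊆ T} * (Fintype.card ι) ^ #S ≤
      (Fintype.card ι).choose t * t ^ #S := by
  set n := Fintype.card ι with hn
  by_cases hst : #S ≤ t
  · by_cases htn : t ≤ n
    · have h1 : #{T ∈ powersetCard t (univ : Finset ι) | S ⊆ T} ≤ (n - #S).choose (t - #S) := by
        rw [← card_compl, ← card_powersetCard]
        refine card_le_card_of_injOn (fun T => T \ S) ?_ ?_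
        · intro T hT
          simp only [mem_coe, mem_filter, mem_powersetCard] at hT
          simp only [mem_coe, mem_powersetCard]
          refine ⟨fun x hx => ?_, ?_⟩
          · simp at hx ⊢; exact hx.2
          · rw [card_sdiff_of_subset hT.2, hT.1.2]
        · intro T hT T' hT' h
          simp only [mem_coe, mem_filter, mem_powersetCard] at hT hT'
          rw [← sdiff_union_of_subset hT.2, ← sdiff_union_of_subset hT'.2]
          simp only at h
          rw [h]
      have h2 := Nat.choose_mul (n := n) (k := t) (s := #S) hst
      have h3 := choose_mul_pow_le htn #S
      have hpos : 0 < n.choose #S := Nat.choose_pos (hst.trans htn)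
      refine Nat.le_of_mul_le_mul_left ?_ hpos
      calc n.choose #S * (#{T ∈ powersetCard t (univ : Finset ι) | S ⊆ T} * n ^ #S)
          ≤ n.choose #S * ((n - #S).choose (t - #S) * n ^ #S) := by gcongr
        _ = n.choose t * (t.choose #S * n ^ #S) := by rw [← mul_assoc, ← h2, mul_assoc]
        _ ≤ n.choose t * (n.choose #S * t ^ #S) := by gcongr
        _ = _ := by ring
    · rw [powersetCard_eq_empty.2 (by simpa [hn] using htn)]
      simp
  · have : #{T ∈ powersetCard t (univ : Finset ι) | S ⊆ T} = 0 := by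
      rw [card_eq_zero, filter_eq_empty_iff]
      intro T hT hS
      rw [mem_powersetCard] at hT
      exact hst (hT.2 ▸ card_le_card hS)
    simp [this]

/-- The moment generating function of the intersection of a fixed `t`-set with a uniformly random
`t`-set is at most that of a binomial distribution. -/
lemma sum_pow_card_inter_le [Nonempty ι] (t : ℕ) (T' : Finset ι) (hT' : #T' = t) {x : ℝ}
    (hx : 0 ≤ x) :
    ∑ T ∈ powersetCard t (univ : Finset ι), (1 + x) ^ #(T ∩ T') ≤
      (Fintype.card ι).choose t * Real.exp (x * t ^ 2 / Fintype.card ι) := by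
  set n := Fintype.card ι with hn
  have hn0 : (0 : ℝ) < n := by exact_mod_cast Fintype.card_pos
  -- Expanding over subsets of `T ∩ T'` reduces the moment generating function to the containment
  -- probabilities just bounded.
  have h1 : ∀ T : Finset ι, (1 + x) ^ #(T ∩ T') =
      ∑ S ∈ T'.powerset, if S ⊆ T then x ^ #S else 0 := by
    intro T
    rw [add_comm, ← Finset.sum_pow_mul_eq_add_pow, ← sum_filter]
    refine sum_congr ?_ fun S _ => by simp
    ext S
    simp only [mem_powerset, mem_filter, subset_inter_iff, and_comm]
  have h2 : ∀ S : Finset ι, (∑ T ∈ powersetCard t (univ : Finset ι), if S ⊆ T then x ^ #S else 0)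
      ≤ n.choose t * (x * t / n) ^ #S := by
    intro S
    rw [← sum_filter, sum_const, nsmul_eq_mul]
    have h : (#{T ∈ powersetCard t (univ : Finset ι) | S ⊆ T} : ℝ) * (n : ℝ) ^ #S ≤
        n.choose t * t ^ #S := by exact_mod_cast card_filter_superset_le S t
    rw [div_pow, mul_pow, ← mul_div_assoc, le_div_iff₀ (by positivity)]
    calc _ = x ^ #S * ((#{T ∈ powersetCard t (univ : Finset ι) | S ⊆ T} : ℝ) * (n : ℝ) ^ #S) := by
          ring
      _ ≤ x ^ #S * (n.choose t * t ^ #S) := by gcongr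
      _ = _ := by ring
  simp_rw [h1]
  rw [sum_comm]
  calc _ ≤ ∑ S ∈ T'.powerset, (n.choose t : ℝ) * (x * t / n) ^ #S := sum_le_sum fun S _ => h2 S
    _ = n.choose t * (x * t / n + 1) ^ t := by
      rw [← mul_sum, ← hT', ← Finset.sum_pow_mul_eq_add_pow]; simp
    _ ≤ n.choose t * (Real.exp (x * t / n)) ^ t := by
      gcongr
      exact Real.add_one_le_exp _
    _ = _ := by
      rw [← Real.exp_nat_mul]; congr 2; ring

end Combinatorics

/-! ### Second moment bound for detecting planted coordinates. -/

section Mixture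

open Finset

/-- The likelihood factor of coordinate `i` when exactly the coordinates in `T` are reweighted. -/
def reweight {ι : Type*} [DecidableEq ι] {X : ι → Type*} (f : ∀ i, X i → ℝ)
    (T : Finset ι) (i : ι) : X i → ℝ :=
  if i ∈ T then f i else 1

lemma reweight_nonneg {ι : Type*} [DecidableEq ι] {X : ι → Type*} {f : ∀ i, X i → ℝ}
    (hf0 : ∀ i x, 0 ≤ f i x) (T : Finset ι) (i : ι) (x : X i) :
    0 ≤ reweight f T i x := by
  unfold reweight
  split_ifs
  · exact hf0 i x
  · exact zero_le_one

/-- The likelihood ratio of the product measure reweighted on `T`. -/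
def likelihood {ι : Type*} [Fintype ι] [DecidableEq ι] {X : ι → Type*}
    (f : ∀ i, X i → ℝ) (T : Finset ι) (x : ∀ i, X i) : ℝ :=
  ∏ i, reweight f T i (x i)

lemma likelihood_nonneg {ι : Type*} [Fintype ι] [DecidableEq ι] {X : ι → Type*}
    {f : ∀ i, X i → ℝ} (hf0 : ∀ i x, 0 ≤ f i x) (T : Finset ι) (x : ∀ i, X i) :
    0 ≤ likelihood f T x := prod_nonneg fun i _ => reweight_nonneg hf0 T i _

lemma integrable_reweight {ι : Type*} [DecidableEq ι] {X : ι → Type*}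
    [∀ i, MeasurableSpace (X i)] {P : ∀ i, Measure (X i)} [∀ i, IsProbabilityMeasure (P i)]
    {f : ∀ i, X i → ℝ} (hint : ∀ i, Integrable (f i) (P i)) (T : Finset ι) (i : ι) :
    Integrable (reweight f T i) (P i) := by
  unfold reweight
  split_ifs
  · exact hint i
  · exact integrable_const 1

variable {ι : Type*} [Fintype ι] [DecidableEq ι] {X : ι → Type*} [∀ i, MeasurableSpace (X i)]

/-- The product measure with factors `Q i` for `i ∈ T` and `P i` otherwise. -/
noncomputable def plantedPi (P Q : ∀ i, Measure (X i)) (T : Finset ι) : Measure (∀ i, X i) :=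
  Measure.pi fun i => if i ∈ T then Q i else P i

variable {P Q : ∀ i, Measure (X i)} [∀ i, IsProbabilityMeasure (P i)]
  [∀ i, IsProbabilityMeasure (Q i)]

instance isProbabilityMeasure_plantedPi (T : Finset ι) :
    IsProbabilityMeasure (plantedPi P Q T) := by
  have : ∀ i, IsProbabilityMeasure (if i ∈ T then Q i else P i) := fun i => by
    split_ifs <;> infer_instance
  unfold plantedPi
  infer_instance

variable {f : ∀ i, X i → ℝ}

lemma integrable_likelihood (hint : ∀ i, Integrable (f i) (P i)) (T : Finset ι) :
    Integrable (likelihood f T) (Measure.pi P) :=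
  Integrable.fintype_prod_dep fun i => integrable_reweight hint T i

lemma measurable_likelihood (hfm : ∀ i, Measurable (f i)) (T : Finset ι) :
    Measurable (likelihood f T) := by
  refine Finset.measurable_prod _ fun i _ => ?_
  have : Measurable (reweight f T i) := by
    unfold reweight
    split_ifs
    · exact hfm i
    · exact measurable_const
  exact this.comp (measurable_pi_apply i)

lemma one_sub_le_integral_likelihood {δ : ℝ} (hδ1 : δ ≤ 1)
    (hmean : ∀ i, 1 - δ ≤ ∫ x, f i x ∂P i) (T : Finset ι) :
    1 - #T * δ ≤ ∫ x, likelihood f T x ∂Measure.pi P := by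
  unfold likelihood
  rw [integral_fintype_prod_eq_prod]
  calc 1 - #T * δ ≤ (1 - δ) ^ #T := by
        have := one_add_mul_le_pow (a := -δ) (by linarith) #T
        rw [← sub_eq_add_neg] at this
        linarith
    _ = ∏ i, if i ∈ T then 1 - δ else 1 := by rw [prod_ite_mem, univ_inter, prod_const]
    _ ≤ _ := by
      refine prod_le_prod (fun i _ => ?_) fun i _ => ?_
      · split_ifs <;> linarith
      · unfold reweight
        split_ifs
        · exact hmean i
        · simp

/-- The integral factors over coordinates: those in both sets contribute a second moment, those in
exactly one a mean, at most 1. -/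
lemma integral_likelihood_mul_le {x : ℝ} (hf0 : ∀ i x, 0 ≤ f i x)
    (hmean : ∀ i, ∫ x, f i x ∂P i ≤ 1) (hsq : ∀ i, ∫ y, f i y ^ 2 ∂P i ≤ 1 + x)
    (T T' : Finset ι) :
    ∫ y, likelihood f T y * likelihood f T' y ∂Measure.pi P ≤ (1 + x) ^ #(T ∩ T') := by
  unfold likelihood
  simp_rw [← prod_mul_distrib]
  rw [integral_fintype_prod_eq_prod fun i y => reweight f T i y * reweight f T' i y]
  calc _ ≤ ∏ i, if i ∈ T ∩ T' then 1 + x else 1 := by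
        refine prod_le_prod (fun i _ => integral_nonneg fun y =>
          mul_nonneg (reweight_nonneg hf0 T i y) (reweight_nonneg hf0 T' i y)) fun i _ => ?_
        unfold reweight
        by_cases h : i ∈ T <;> by_cases h' : i ∈ T'
        · simpa [h, h', ← sq] using hsq i
        · simpa [h, h'] using hmean i
        · simpa [h, h'] using hmean i
        · simp [h, h']
    _ = _ := by rw [prod_ite_mem, univ_inter, prod_const]

lemma integrable_likelihood_mul (hint : ∀ i, Integrable (f i) (P i))
    (hsqint : ∀ i, Integrable (fun x => f i x ^ 2) (P i)) (T T' : Finset ι) :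
    Integrable (fun y => likelihood f T y * likelihood f T' y) (Measure.pi P) := by
  unfold likelihood
  simp_rw [← prod_mul_distrib]
  refine Integrable.fintype_prod_dep (f := fun i y => reweight f T i y * reweight f T' i y)
    fun i => ?_
  unfold reweight
  by_cases h : i ∈ T <;> by_cases h' : i ∈ T'
  · simpa [h, h', ← sq] using hsqint i
  · simpa [h, h'] using hint i
  · simpa [h, h'] using hint i
  · simp [h, h']

lemma integral_plantedPi_le (hfm : ∀ i, Measurable (f i)) (hf0 : ∀ i x, 0 ≤ f i x)
    (hint : ∀ i, Integrable (f i) (P i))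
    (hdom : ∀ i, (P i).withDensity (fun x => ENNReal.ofReal (f i x)) ≤ Q i)
    {δ : ℝ} (hδ1 : δ ≤ 1) (hmean : ∀ i, 1 - δ ≤ ∫ x, f i x ∂P i)
    {φ : (∀ i, X i) → ℝ} (hφm : Measurable φ) (hφ0 : ∀ x, 0 ≤ φ x) (hφ1 : ∀ x, φ x ≤ 1)
    (T : Finset ι) :
    ∫ x, φ x ∂plantedPi P Q T ≤ ∫ x, φ x * likelihood f T x ∂Measure.pi P + #T * δ := by
  have hle : (Measure.pi P).withDensity (fun x => ENNReal.ofReal (likelihood f T x)) ≤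
      plantedPi P Q T := by
    unfold likelihood
    rw [← pi_withDensity_ofReal (fun i => reweight_nonneg hf0 T i)
      fun i => integrable_reweight hint T i]
    have : ∀ i, IsFiniteMeasure
        ((P i).withDensity fun x => ENNReal.ofReal (reweight f T i x)) := fun i =>
      isFiniteMeasure_withDensity_ofReal (integrable_reweight hint T i).2
    refine measure_pi_mono fun i => ?_
    unfold reweight
    split_ifs
    · exact hdom i
    · simp
  have hφint : ∀ (μ : Measure (∀ i, X i)) [IsFiniteMeasure μ], Integrable φ μ := fun μ _ =>
    Integrable.of_bound hφm.aestronglyMeasurable 1 (Filter.Eventually.of_forall fun x => by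
      rw [Real.norm_eq_abs, abs_of_nonneg (hφ0 x)]; exact hφ1 x)
  have hLint := integrable_likelihood hint T
  have hφL : Integrable (fun x => φ x * likelihood f T x) (Measure.pi P) :=
    hLint.bdd_mul hφm.aestronglyMeasurable (c := 1) (Filter.Eventually.of_forall fun x => by
      rw [Real.norm_eq_abs, abs_of_nonneg (hφ0 x)]; exact hφ1 x)
  -- Domination bounds planted integrals only from below, so it is applied to `1 - φ`; the lost mass
  -- becomes the error `#T * δ`.
  have h1 : ∫ x, (1 - φ x) ∂(Measure.pi P).withDensity
      (fun x => ENNReal.ofReal (likelihood f T x)) ≤ ∫ x, (1 - φ x) ∂plantedPi P Q T :=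
    integral_mono_measure hle (Filter.Eventually.of_forall fun x => sub_nonneg.2 (hφ1 x))
      ((integrable_const 1).sub (hφint _))
  rw [integral_withDensity_eq_integral_toReal_smul
    (measurable_likelihood hfm T).ennreal_ofReal (by simp),
    integral_sub (integrable_const 1) (hφint _)] at h1
  have h2 : ∫ x, (ENNReal.ofReal (likelihood f T x)).toReal • (1 - φ x) ∂Measure.pi P =
      ∫ x, likelihood f T x ∂Measure.pi P - ∫ x, φ x * likelihood f T x ∂Measure.pi P := by
    rw [← integral_sub hLint hφL]
    refine integral_congr_ae (Filter.Eventually.of_forall fun x => ?_)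
    simp only [ENNReal.toReal_ofReal (likelihood_nonneg hf0 T x), smul_eq_mul]
    ring
  rw [h2] at h1
  have h3 := one_sub_le_integral_likelihood hδ1 hmean T
  simp at h1
  linarith

/-- Planting the laws `Q i` at a uniformly random set of `t` coordinates of a product measure with
factors `P i` is hard to detect if `Q i` and `P i` are `(ε, δ)`-indistinguishable and `ε * t` is a
small multiple of the square root of the number of coordinates. -/
theorem sum_integral_plantedPi_le [Nonempty ι] {ε δ : ℝ} (hε₀ : 0 ≤ ε) (hε₁ : ε ≤ 1)
    (hδ : 0 ≤ δ) (hδn : Fintype.card ι * δ ≤ 1 / 100) {t : ℕ} (ht : t ≤ Fintype.card ι)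
    (htε : t * ε ≤ 1 / 100 * √(Fintype.card ι : ℝ))
    (hPQ : ∀ i, Indistinguishable ε δ (Q i) (P i))
    {φ : (∀ i, X i) → ℝ} (hφm : Measurable φ) (hφ0 : ∀ x, 0 ≤ φ x) (hφ1 : ∀ x, φ x ≤ 1) :
    ∑ T ∈ powersetCard t (univ : Finset ι), ∫ x, φ x ∂plantedPi P Q T ≤
      (Fintype.card ι).choose t * (∫ x, φ x ∂Measure.pi P + 3 / 10) := by
  choose f hfm hf0 hfe hdom hmean hmean' hsq using fun i =>
    (hPQ i).exists_truncated_density hε₀ hε₁ hδ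
  set n := Fintype.card ι with hn
  have hn1 : (1 : ℝ) ≤ n := by exact_mod_cast Fintype.card_pos (α := ι)
  have htn : (t : ℝ) ≤ n := by exact_mod_cast ht
  have htδ : t * δ ≤ 1 / 100 := (mul_le_mul_of_nonneg_right htn hδ).trans hδn
  have hδ1 : δ ≤ 1 := by nlinarith
  set x := 6 * ε ^ 2 + 2 * δ with hx
  have hx0 : 0 ≤ x := by positivity
  -- The exponent is at most `6/10000` from `ε` plus `200/10000` from `δ`, and `exp u ≤ 1 + 2u` for
  -- `0 ≤ u ≤ 1`.
  have hexp : Real.exp (x * t ^ 2 / n) ≤ 1 + 413 / 10000 := by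
    have h0 : 0 ≤ x * t ^ 2 / n := by positivity
    have h1 : x * t ^ 2 / n ≤ 206 / 10000 := by
      rw [div_le_iff₀ (by linarith)]
      have h2 : ((t : ℝ) * ε) ^ 2 ≤ (n : ℝ) / 10000 := by
        calc ((t : ℝ) * ε) ^ 2 ≤ (1 / 100 * √(n : ℝ)) ^ 2 := by gcongr
          _ = (n : ℝ) / 10000 := by rw [mul_pow, Real.sq_sqrt (by linarith)]; ring
      have h3 : (t * δ) * t ≤ 1 / 100 * (n : ℝ) := by gcongr
      nlinarith
    have h4 := Real.abs_exp_sub_one_le (x := x * t ^ 2 / n) (by rw [abs_of_nonneg h0]; linarith)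
    rw [abs_of_nonneg h0] at h4
    linarith [le_abs_self (Real.exp (x * t ^ 2 / n) - 1)]
  have hint : ∀ i, Integrable (f i) (P i) := fun i =>
    Integrable.of_bound (hfm i).aestronglyMeasurable (Real.exp ε)
      (Filter.Eventually.of_forall fun y => by
        rw [Real.norm_eq_abs, abs_of_nonneg (hf0 i y)]; exact hfe i y)
  have hsqint : ∀ i, Integrable (fun y => f i y ^ 2) (P i) := fun i =>
    Integrable.of_bound ((hfm i).pow_const 2).aestronglyMeasurable (Real.exp ε ^ 2)
      (Filter.Eventually.of_forall fun y => by
        rw [Real.norm_eq_abs, abs_of_nonneg (sq_nonneg _)]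
        exact pow_le_pow_left₀ (hf0 i y) (hfe i y) 2)
  set F := powersetCard t (univ : Finset ι) with hF
  have hFcard : ∀ T ∈ F, #T = t := fun T hT => (mem_powersetCard.1 hT).2
  set C : ℝ := (n.choose t : ℝ) with hC
  have hC0 : 0 < C := Nat.cast_pos.2 (Nat.choose_pos ht)
  have hFC : (#F : ℝ) = C := by rw [hF, card_powersetCard, card_univ]
  set Λ : (∀ i, X i) → ℝ := fun y => ∑ T ∈ F, likelihood f T y with hΛ
  have hLint := fun T => integrable_likelihood (P := P) hint T
  have hLLint := fun T T' => integrable_likelihood_mul (P := P) hint hsqint T T'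
  have hΛint : Integrable Λ (Measure.pi P) := integrable_finsetSum _ fun T _ => hLint T
  have hsqΛ : ∀ y, (Λ y - C) ^ 2 = (∑ T' ∈ F, ∑ T ∈ F, likelihood f T y * likelihood f T' y)
      - (2 * C * Λ y - C ^ 2) := by
    intro y
    have : Λ y * Λ y = ∑ T' ∈ F, ∑ T ∈ F, likelihood f T y * likelihood f T' y := by
      rw [hΛ, sum_mul_sum, sum_comm]
    rw [← this]; ring
  have hi1 : Integrable (fun y => ∑ T' ∈ F, ∑ T ∈ F, likelihood f T y * likelihood f T' y)
      (Measure.pi P) :=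
    integrable_finsetSum _ fun T' _ => integrable_finsetSum _ fun T _ => hLLint T T'
  have hi2 : Integrable (fun y => 2 * C * Λ y - C ^ 2) (Measure.pi P) :=
    (hΛint.const_mul _).sub (integrable_const _)
  have hi3 : Integrable (fun y => (Λ y - C) ^ 2) (Measure.pi P) := by
    simp_rw [hsqΛ]; exact hi1.sub hi2
  have hΛmean : C * (1 - 1 / 100) ≤ ∫ y, Λ y ∂Measure.pi P := by
    rw [integral_finsetSum _ fun T _ => hLint T, ← hFC, ← nsmul_eq_mul]
    refine card_nsmul_le_sum _ _ _ fun T hT => ?_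
    have := one_sub_le_integral_likelihood hδ1 hmean T
    rw [hFcard T hT] at this
    linarith
  -- In units of `C ^ 2`: `1.0413 - 2 * 0.99 + 1 = 0.0613`.
  have hvar : ∫ y, (Λ y - C) ^ 2 ∂Measure.pi P ≤ C ^ 2 * (613 / 10000) := by
    simp_rw [hsqΛ]
    rw [integral_sub hi1 hi2, integral_sub (hΛint.const_mul _) (integrable_const _),
      integral_const_mul,
      integral_finsetSum _ fun T' _ => integrable_finsetSum _ fun T _ => hLLint T T']
    have h1 : ∑ T' ∈ F, ∫ y, ∑ T ∈ F, likelihood f T y * likelihood f T' y ∂Measure.pi P ≤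
        C * (C * (1 + 413 / 10000)) := by
      calc _ ≤ #F • (C * (1 + 413 / 10000)) := ?_
        _ = _ := by rw [nsmul_eq_mul, hFC]
      refine sum_le_card_nsmul _ _ _ fun T' hT' => ?_
      rw [integral_finsetSum _ fun T _ => hLLint T T']
      calc _ ≤ ∑ T ∈ F, (1 + x) ^ #(T ∩ T') :=
            sum_le_sum fun T _ => integral_likelihood_mul_le hf0 hmean' hsq T T'
        _ ≤ _ := sum_pow_card_inter_le t T' (hFcard T' hT') hx0
        _ ≤ _ := by gcongr
    simp only [integral_const, probReal_univ, one_smul]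
    nlinarith
  have hbdd : ∀ᵐ y ∂Measure.pi P, ‖φ y‖ ≤ 1 := Filter.Eventually.of_forall fun y => by
    rw [Real.norm_eq_abs, abs_of_nonneg (hφ0 y)]; exact hφ1 y
  have hφint : Integrable φ (Measure.pi P) := Integrable.of_bound hφm.aestronglyMeasurable 1 hbdd
  have hφL : ∀ T, Integrable (fun y => φ y * likelihood f T y) (Measure.pi P) := fun T =>
    (hLint T).bdd_mul hφm.aestronglyMeasurable hbdd
  have hφΛ : Integrable (fun y => φ y * Λ y) (Measure.pi P) :=
    hΛint.bdd_mul hφm.aestronglyMeasurable hbdd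
  have hkey : ∫ y, φ y * Λ y ∂Measure.pi P ≤
      C * ∫ y, φ y ∂Measure.pi P + C * (1 / 10 + 5 / 2 * (613 / 10000)) := by
    have hpt : ∀ y, φ y * Λ y ≤ C * φ y + (5 / 2 / C * (Λ y - C) ^ 2 + C / 10) := by
      intro y
      have h1 : φ y * (Λ y - C) ≤ |Λ y - C| := by
        calc φ y * (Λ y - C) ≤ φ y * |Λ y - C| :=
              mul_le_mul_of_nonneg_left (le_abs_self _) (hφ0 y)
          _ ≤ 1 * |Λ y - C| := mul_le_mul_of_nonneg_right (hφ1 y) (abs_nonneg _)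
          _ = _ := one_mul _
      -- Weighted AM-GM. With the variance bound the relative error is `0.1 + 2.5 * 0.0613`; adding
      -- the truncation loss `0.01` keeps it below `0.3`.
      have h2 : |Λ y - C| ≤ 5 / 2 / C * (Λ y - C) ^ 2 + C / 10 := by
        rw [← sq_abs (Λ y - C)]
        set a := |Λ y - C|
        have h3 : 5 / 2 / C * a ^ 2 + C / 10 - a = 5 / 2 / C * (a - C / 5) ^ 2 := by
          field_simp; ring
        have : 0 ≤ 5 / 2 / C * (a - C / 5) ^ 2 := by positivity
        linarith
      linarith
    have hi4 : Integrable (fun y => 5 / 2 / C * (Λ y - C) ^ 2 + C / 10) (Measure.pi P) :=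
      (hi3.const_mul _).add (integrable_const _)
    calc _ ≤ ∫ y, (C * φ y + (5 / 2 / C * (Λ y - C) ^ 2 + C / 10)) ∂Measure.pi P :=
          integral_mono hφΛ ((hφint.const_mul C).add hi4) hpt
      _ = C * ∫ y, φ y ∂Measure.pi P +
          (5 / 2 / C * ∫ y, (Λ y - C) ^ 2 ∂Measure.pi P + C / 10) := by
        rw [integral_add (hφint.const_mul C) hi4,
          integral_add (hi3.const_mul _) (integrable_const _), integral_const_mul,
          integral_const_mul]
        simp
      _ ≤ C * ∫ y, φ y ∂Measure.pi P +
          (5 / 2 / C * (C ^ 2 * (613 / 10000)) + C / 10) := by gcongr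
      _ = _ := by field_simp; ring
  calc _ ≤ ∑ T ∈ F, (∫ y, φ y * likelihood f T y ∂Measure.pi P + 1 / 100) := by
        refine sum_le_sum fun T hT => ?_
        have := integral_plantedPi_le hfm hf0 hint hdom hδ1 hmean hφm hφ0 hφ1 T
        rw [hFcard T hT] at this
        linarith
    _ = ∫ y, φ y * Λ y ∂Measure.pi P + C * (1 / 100) := by
      rw [sum_add_distrib, ← integral_finsetSum _ fun T _ => hφL T, sum_const, nsmul_eq_mul, hFC]
      simp_rw [hΛ, mul_sum]
    _ ≤ _ := by nlinarith

lemma sum_lintegral_plantedPi_le {ι : Type*} [Fintype ι] [DecidableEq ι] [Nonempty ι]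
    {X : ι → Type*} [∀ i, MeasurableSpace (X i)] {P Q : ∀ i, Measure (X i)}
    [∀ i, IsProbabilityMeasure (P i)] [∀ i, IsProbabilityMeasure (Q i)]
    {ε δ : ℝ} (hε₀ : 0 ≤ ε) (hε₁ : ε ≤ 1)
    (hδ : 0 ≤ δ) (hδn : Fintype.card ι * δ ≤ 1 / 100) {t : ℕ} (ht : t ≤ Fintype.card ι)
    (htε : t * ε ≤ 1 / 100 * √(Fintype.card ι : ℝ))
    (hPQ : ∀ i, Indistinguishable ε δ (Q i) (P i))
    {φ : (∀ i, X i) → ℝ≥0∞} (hφm : Measurable φ) (hφ1 : ∀ x, φ x ≤ 1) :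
    ∑ T ∈ powersetCard t (univ : Finset ι), ∫⁻ x, φ x ∂plantedPi P Q T ≤
      (Fintype.card ι).choose t * (∫⁻ x, φ x ∂Measure.pi P + ENNReal.ofReal (3 / 10)) := by
  have hfin : ∀ x, φ x ≠ ∞ := fun x => ((hφ1 x).trans_lt ENNReal.one_lt_top).ne
  have h1 : ∀ x, (φ x).toReal ≤ 1 := fun x => by
    simpa using ENNReal.toReal_mono ENNReal.one_ne_top (hφ1 x)
  have hconv : ∀ (μ : Measure (∀ i, X i)) [IsFiniteMeasure μ],
      ∫⁻ x, φ x ∂μ = ENNReal.ofReal (∫ x, (φ x).toReal ∂μ) := by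
    intro μ _
    rw [ofReal_integral_eq_lintegral_ofReal]
    · exact lintegral_congr fun x => (ENNReal.ofReal_toReal (hfin x)).symm
    · refine Integrable.of_bound hφm.ennreal_toReal.aestronglyMeasurable 1
        (Filter.Eventually.of_forall fun x => ?_)
      rw [Real.norm_eq_abs, abs_of_nonneg ENNReal.toReal_nonneg]
      exact h1 x
    · exact Filter.Eventually.of_forall fun x => ENNReal.toReal_nonneg
  simp_rw [hconv]
  rw [← ENNReal.ofReal_sum_of_nonneg fun T _ => integral_nonneg fun x => ENNReal.toReal_nonneg,
    ← ENNReal.ofReal_add (integral_nonneg fun x => ENNReal.toReal_nonneg) (by norm_num),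
    ← ENNReal.ofReal_natCast, ← ENNReal.ofReal_mul (Nat.cast_nonneg _)]
  exact ENNReal.ofReal_le_ofReal (sum_integral_plantedPi_le hε₀ hε₁ hδ hδn ht htε hPQ
    hφm.ennreal_toReal (fun x => ENNReal.toReal_nonneg) h1)

end Mixture

/-! ### Degrees in starpartite and regular graphs. -/

section Graphs

variable {n : ℕ}

lemma ncard_neighborSet_starpartiteGraph (T : Finset (Fin n)) (i : Fin n) :
    ((starpartiteGraph T).neighborSet i).ncard = if i ∈ T then n - 1 else T.card := by
  split_ifs with h
  · have : (starpartiteGraph T).neighborSet i = {i}ᶜ := by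
      ext j
      simp [starpartiteGraph, h, eq_comm]
    rw [this, Set.ncard_compl, Set.ncard_singleton, Nat.card_eq_fintype_card, Fintype.card_fin]
  · have : (starpartiteGraph T).neighborSet i = (T : Set (Fin n)) := by
      ext j
      simp only [starpartiteGraph, SimpleGraph.mem_neighborSet, h, false_or, Finset.mem_coe]
      exact ⟨fun h' => h'.2, fun h' => ⟨fun e => h (e ▸ h'), h'⟩⟩
    rw [this, Set.ncard_coe_finset]

/-- The center consists of the nodes of degree `n - 1`. For `t = n - 1` every center gives the
complete graph. -/
lemma starpartiteGraph_injOn {t : ℕ} (ht : t ≠ n - 1) :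
    Set.InjOn (starpartiteGraph (n := n)) {T | T.card = t} := by
  intro T hT T' hT' h
  have key : ∀ S : Finset (Fin n), S.card = t → ∀ i,
      i ∈ S ↔ ((starpartiteGraph S).neighborSet i).ncard = n - 1 := by
    intro S hS i
    rw [ncard_neighborSet_starpartiteGraph, hS]
    split_ifs with h <;> simp [h, ht]
  ext i
  rw [key T hT, key T' hT', h]

lemma starpartiteGraphs_eq_image (n t : ℕ) [DecidableEq (SimpleGraph (Fin n))] :
    starpartiteGraphs n t = (Finset.powersetCard t Finset.univ).image starpartiteGraph := by
  ext G
  simp [starpartiteGraphs, Finset.mem_powersetCard, eq_comm]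

lemma ncard_neighborSet_of_mem_regularGraphs {t : ℕ} {G : SimpleGraph (Fin n)}
    (hG : G ∈ regularGraphs n t) (i : Fin n) : (G.neighborSet i).ncard = t := by
  classical
  simp only [regularGraphs, Finset.mem_filter] at hG
  rw [← hG.2 i, ← SimpleGraph.coe_neighborFinset, Set.ncard_coe_finset,
    SimpleGraph.card_neighborFinset_eq_degree]

lemma notMem_neighborSet_self (G : SimpleGraph (Fin n)) (i : Fin n) : i ∉ G.neighborSet i := by
  simp

end Graphs

/-! ### From node privacy of the protocol to the planted product measures. -/

namespace LocalProtocol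

variable {n : ℕ} {Y : Type w} [MeasurableSpace Y] {p : LocalProtocol.{u, v, w} n Y}

instance isProbabilityMeasure_transcript (G : SimpleGraph (Fin n)) (ρ : p.Pub) :
    IsProbabilityMeasure (p.transcript G ρ) :=
  inferInstanceAs (IsProbabilityMeasure
    (Measure.pi fun i => p.randomizer i (G.neighborSet i) ρ))

instance isMarkovKernel_transcript (G : SimpleGraph (Fin n)) :
    IsMarkovKernel (p.transcript G) := ⟨fun ρ => isProbabilityMeasure_transcript G ρ⟩

instance isProbabilityMeasure_output (G : SimpleGraph (Fin n)) :
    IsProbabilityMeasure (p.output G) := by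
  unfold output
  infer_instance

lemma transcript_apply_eval_preimage (G : SimpleGraph (Fin n)) (ρ : p.Pub) (i : Fin n)
    {E : Set (p.Msg i)} (hE : MeasurableSet E) :
    p.transcript G ρ (Function.eval i ⁻¹' E) = p.randomizer i (G.neighborSet i) ρ E :=
  (measurePreserving_eval (fun i => p.randomizer i (G.neighborSet i) ρ) i).measure_preimage
    hE.nullMeasurableSet

/-- Each randomizer of a node-private protocol is `(ε, δ)`-private with respect to arbitrary
changes of the neighborhood. -/
lemma NodePrivate.randomizer_indistinguishable {ε δ : ℝ} (hp : p.NodePrivate ε δ) {i : Fin n}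
    {S S' : Set (Fin n)} (hS : i ∉ S) (hS' : i ∉ S') (ρ : p.Pub) :
    Indistinguishable ε δ (p.randomizer i S ρ) (p.randomizer i S' ρ) := by
  -- Stars centered at `i` realize every neighborhood of `i` and are pairwise node neighbors; the
  -- marginal at `i` isolates its randomizer.
  let spokes : Set (Fin n) → SimpleGraph (Fin n) := fun S =>
    SimpleGraph.fromRel fun a b => a = i ∧ b ∈ S
  have hnbr : ∀ S : Set (Fin n), i ∉ S → (spokes S).neighborSet i = S := by
    intro S hS
    ext j
    simp only [spokes, SimpleGraph.mem_neighborSet, SimpleGraph.fromRel_adj, true_and]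
    constructor
    · rintro ⟨-, h | h⟩
      · exact h
      · exact absurd h.2 hS
    · exact fun h => ⟨fun e => hS (e ▸ h), Or.inl h⟩
  have hn : NodeNeighbors (spokes S) (spokes S') :=
    ⟨i, fun a b ha hb => by simp [spokes, ha, hb]⟩
  intro E hE
  have := hp _ _ hn ρ (Function.eval i ⁻¹' E) (measurable_pi_apply i hE)
  rwa [transcript_apply_eval_preimage _ _ _ hE, transcript_apply_eval_preimage _ _ _ hE,
    hnbr S hS, hnbr S' hS'] at this

lemma DegreesOnly.transcript_congr (hp : p.DegreesOnly) {G G' : SimpleGraph (Fin n)}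
    (h : ∀ i, (G.neighborSet i).ncard = (G'.neighborSet i).ncard) :
    p.transcript G = p.transcript G' := by
  ext1 ρ
  change Measure.pi _ = Measure.pi _
  congr 1
  funext i
  rw [hp i _ _ (notMem_neighborSet_self G i) (notMem_neighborSet_self G' i) (h i)]

/-- Nodes outside `T` have degree `t`, as in `G`; those in `T` are adjacent to all others, and
`{i}ᶜ` makes their law independent of `T`. -/
lemma DegreesOnly.transcript_starpartiteGraph (hp : p.DegreesOnly) {t : ℕ}
    {G : SimpleGraph (Fin n)} (hG : G ∈ regularGraphs n t) {T : Finset (Fin n)}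
    (hT : T.card = t) (ρ : p.Pub) :
    p.transcript (starpartiteGraph T) ρ =
      plantedPi (fun i => p.randomizer i (G.neighborSet i) ρ)
        (fun i => p.randomizer i {i}ᶜ ρ) T := by
  change Measure.pi _ = Measure.pi _
  congr 1
  funext i
  have h := ncard_neighborSet_starpartiteGraph T i
  split_ifs with hi
  · rw [hp i _ {i}ᶜ (notMem_neighborSet_self _ i) (by simp)]
    rw [h, if_pos hi, Set.ncard_compl, Set.ncard_singleton, Nat.card_eq_fintype_card,
      Fintype.card_fin]
  · rw [hp i _ _ (notMem_neighborSet_self _ i) (notMem_neighborSet_self G i)]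
    rw [h, if_neg hi, hT, ncard_neighborSet_of_mem_regularGraphs hG]

lemma output_apply (G : SimpleGraph (Fin n)) {s : Set Y} (hs : MeasurableSet s) :
    p.output G s = ∫⁻ ρ, ∫⁻ m, p.post m s ∂p.transcript G ρ ∂p.pubLaw := by
  unfold output
  rw [Measure.bind_apply hs p.post.aemeasurable,
    Measure.lintegral_bind (p.transcript G).aemeasurable (p.post.measurable_coe hs).aemeasurable]

/-- On average over the starpartite graphs, every event has at most `3 / 10` more probability than
on a regular graph. -/
theorem sum_output_starpartiteGraphs_le {ε δ : ℝ} (hε₀ : 0 ≤ ε) (hε₁ : ε ≤ 1) (hδ : 0 ≤ δ)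
    (hδn : n * δ ≤ 1 / 100) {t : ℕ} (htε : t * ε ≤ 1 / 100 * √(n : ℝ)) (hn : 0 < n)
    (hpriv : p.NodePrivate ε δ) (hdeg : p.DegreesOnly) {G₀ : SimpleGraph (Fin n)}
    (hG₀ : G₀ ∈ regularGraphs n t) {s : Set Y} (hs : MeasurableSet s) :
    ∑ G ∈ starpartiteGraphs n t, p.output G s ≤
      (starpartiteGraphs n t).card * (p.output G₀ s + ENNReal.ofReal (3 / 10)) := by
  classical
  -- Here centers do not determine graphs, but all degrees equal `t`, so both families give the same
  -- transcript.
  by_cases ht : t = n - 1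
  · rw [← nsmul_eq_mul]
    refine Finset.sum_le_card_nsmul _ _ _ fun G hG => ?_
    rw [starpartiteGraphs_eq_image] at hG
    obtain ⟨T, hT, rfl⟩ := Finset.mem_image.1 hG
    have hT' := (Finset.mem_powersetCard.1 hT).2
    have : p.transcript (starpartiteGraph T) = p.transcript G₀ := by
      refine hdeg.transcript_congr fun i => ?_
      rw [ncard_neighborSet_starpartiteGraph, ncard_neighborSet_of_mem_regularGraphs hG₀, hT', ht,
        ite_self]
    unfold output
    rw [this]
    exact le_self_add
  · have : Nonempty (Fin n) := ⟨⟨0, hn⟩⟩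
    have hinj : Set.InjOn (starpartiteGraph (n := n))
        (Finset.powersetCard t (Finset.univ : Finset (Fin n))) := fun T hT T' hT' h =>
      starpartiteGraph_injOn ht (Finset.mem_powersetCard.1 hT).2
        (Finset.mem_powersetCard.1 hT').2 h
    have htn : t ≤ n := by
      rw [← ncard_neighborSet_of_mem_regularGraphs hG₀ ⟨0, hn⟩]
      simpa using Set.ncard_le_ncard (Set.subset_univ (G₀.neighborSet ⟨0, hn⟩))
    have hm : ∀ G : SimpleGraph (Fin n),
        Measurable fun ρ => ∫⁻ m, p.post m s ∂p.transcript G ρ := fun G =>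
      (p.post.measurable_coe hs).lintegral_kernel
    rw [starpartiteGraphs_eq_image, Finset.sum_image hinj, Finset.card_image_of_injOn hinj,
      Finset.card_powersetCard, Finset.card_univ]
    simp_rw [output_apply _ hs]
    rw [← lintegral_finsetSum _ fun T _ => hm _]
    calc _ ≤ ∫⁻ ρ, (Fintype.card (Fin n)).choose t *
          (∫⁻ m, p.post m s ∂p.transcript G₀ ρ + ENNReal.ofReal (3 / 10)) ∂p.pubLaw := by
          refine lintegral_mono fun ρ => ?_
          -- For fixed `ρ`, postprocessing is the `[0, 1]`-valued test `m ↦ p.post m s`.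
          refine le_trans (Finset.sum_le_sum fun T hT => ?_)
            (sum_lintegral_plantedPi_le (P := fun i => p.randomizer i (G₀.neighborSet i) ρ)
              (Q := fun i => p.randomizer i {i}ᶜ ρ) hε₀ hε₁ hδ (by simpa using hδn)
              (by simpa using htn) (by simpa using htε)
              (fun i => hpriv.randomizer_indistinguishable (by simp)
                (notMem_neighborSet_self G₀ i) ρ)
              (p.post.measurable_coe hs) fun m => prob_le_one)
          rw [hdeg.transcript_starpartiteGraph hG₀ (Finset.mem_powersetCard.1 hT).2]
      _ = _ := by
        rw [lintegral_const_mul' _ _ (ENNReal.natCast_ne_top _), lintegral_add_right _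
          measurable_const]
        simp

end LocalProtocol

/-! ### Averaging over graphs and the conclusion. -/

lemma outputProb_uniformOfFinset {n : ℕ} {Y : Type w} [MeasurableSpace Y]
    (s : Finset (SimpleGraph (Fin n))) (hs : s.Nonempty) (A : SimpleGraph (Fin n) → Measure Y)
    (y : Y) :
    outputProb (PMF.uniformOfFinset s hs) A y = (s.card : ℝ≥0∞)⁻¹ * ∑ G ∈ s, A G {y} := by
  classical
  unfold outputProb
  simp only [PMF.uniformOfFinset_apply, ite_mul, zero_mul]
  rw [Finset.mul_sum, ← Finset.sum_filter]
  refine Finset.sum_congr ?_ fun _ _ => rfl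
  ext G
  simp

lemma outputProb_uniformOfFinset_le {n : ℕ} {Y : Type w} [MeasurableSpace Y]
    {s : Finset (SimpleGraph (Fin n))} (hs : s.Nonempty) {A : SimpleGraph (Fin n) → Measure Y}
    {y : Y} {b : ℝ≥0∞} (h : ∑ G ∈ s, A G {y} ≤ s.card * b) :
    outputProb (PMF.uniformOfFinset s hs) A y ≤ b := by
  rw [outputProb_uniformOfFinset]
  calc _ ≤ (s.card : ℝ≥0∞)⁻¹ * (s.card * b) := by gcongr
    _ = b := by
      rw [← mul_assoc, ENNReal.inv_mul_cancel (by simpa using hs.ne_empty) (by simp), one_mul]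

theorem mainTheorem12 :
    ∃ c : ℝ, 0 < c ∧ ∃ N : ℕ, ∀ n : ℕ, N ≤ n →
      ∀ ε δ : ℝ, 0 < ε → ε ≤ 1 → 0 < δ → δ ≤ 1 / (100 * (n : ℝ)) →
      ∀ t : ℕ, (t : ℝ) ≤ c * √(n : ℝ) / ε →
      ∀ (hstar : (starpartiteGraphs n t).Nonempty) (hreg : (regularGraphs n t).Nonempty)
        (Y : Type w) [MeasurableSpace Y] [MeasurableSingletonClass Y]
        (starpartite regular : Y), starpartite ≠ regular →
      ∀ A : SimpleGraph (Fin n) → Measure Y, IsDegreesOnlyLNDP.{u, v, w} ε δ A →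
        outputProb (PMF.uniformOfFinset (starpartiteGraphs n t) hstar) A starpartite < 2 / 3 ∨
        outputProb (PMF.uniformOfFinset (regularGraphs n t) hreg) A regular < 2 / 3 := by
  refine ⟨1 / 100, by norm_num, 1, ?_⟩
  rintro n hn ε δ hε₀ hε₁ hδ₀ hδ t ht hstar hreg Y _ _ y₁ y₂ hy A ⟨p, hA, hpriv, hdeg⟩
  obtain rfl : A = p.output := funext hA
  obtain ⟨G₀, hG₀⟩ := hreg
  have hn0 : (0 : ℝ) < n := by exact_mod_cast hn
  have hδn : n * δ ≤ 1 / 100 := by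
    rw [le_div_iff₀ (by positivity)] at hδ
    linarith
  have hstar_le := outputProb_uniformOfFinset_le hstar
    (p.sum_output_starpartiteGraphs_le hε₀.le hε₁ hδ₀.le hδn ((le_div_iff₀ hε₀).1 ht) hn hpriv hdeg
      hG₀ (measurableSet_singleton y₁))
  -- All `t`-regular graphs have the same output law, so `G₀` stands for their average.
  have hreg_le : outputProb (PMF.uniformOfFinset (regularGraphs n t) ⟨G₀, hG₀⟩) p.output y₂ ≤
      p.output G₀ {y₂} := by
    refine outputProb_uniformOfFinset_le _ ?_
    rw [← nsmul_eq_mul]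
    refine Finset.sum_le_card_nsmul _ _ _ fun G hG => ?_
    unfold LocalProtocol.output
    rw [hdeg.transcript_congr fun i => (ncard_neighborSet_of_mem_regularGraphs hG i).trans
      (ncard_neighborSet_of_mem_regularGraphs hG₀ i).symm]
  have hsum : p.output G₀ {y₁} + p.output G₀ {y₂} ≤ 1 := by
    rw [← measure_union (by simpa using hy) (measurableSet_singleton y₂)]
    exact prob_le_one
  by_contra! h
  have h1 := add_le_add (h.1.trans hstar_le) (h.2.trans hreg_le)
  -- The two answers are disjoint events under the output law on `G₀`, and `4/3 > 1.3`.
  have h2 : (2 / 3 + 2 / 3 : ℝ≥0∞) ≤ 1 + ENNReal.ofReal (3 / 10) := by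
    refine h1.trans ?_
    rw [add_right_comm]
    gcongr
  have h3 := ENNReal.toReal_mono (by finiteness) h2
  rw [ENNReal.toReal_add (by finiteness) (by finiteness),
    ENNReal.toReal_add (by finiteness) (by finiteness)] at h3
  norm_num at h3
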